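/- Let $K_0$ be a non-archimedean local field (a complete discretely valued field with finite residue field $\kappa_0$, of any characteristic), let $m \ge 3$ be an integer such that $2m$ is coprime to $\mathrm{char}(\kappa_0)$, let $L/K_0$ be a field extension of degree $2m$, and let $\pi \in K_0$ be a parameter (uniformizer). Call a field extension $E/F$ dihedral if it is Galois and its Galois group is isomorphic to the dihedral group of order $2n$ for some $n \ge 2$. Then $L/K_0$ is dihedral if and only if there exists a primitive $m$-th root of unity $\rho \in L$ such that $[K_0(\rho):K_0] = 2$, $N_{K_0(\rho)/K_0}(\rho) = 1$, and $L = K_0(\rho, \sqrt[m]{\pi})$, i.e. $L = K_0(\rho,\alpha)$ for some $\alpha \in L$ with $\alpha^m = \pi$. -/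

import Mathlib

open scoped ValuativeRel

/-- A field extension `E/F` is *dihedral* if it is Galois and its Galois group is isomorphic to the
dihedral group of order `2n` (the symmetries of the regular `n`-gon) for some `n ≥ 2`. -/
def IsDihedralExtension (F E : Type*) [Field F] [Field E] [Algebra F E] : Prop :=
  IsGalois F E ∧ ∃ n : ℕ, 2 ≤ n ∧ Nonempty ((E ≃ₐ[F] E) ≃* DihedralGroup n)

/-! From dihedral to the explicit form, let `σ`, `τ` be a rotation of order `m` and a reflection,
acting on the valuation ring `B` of `L`. Since `2m` is a unit in `B`, the tame character `g ↦ gϖ/ϖ`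
modulo the maximal ideal is faithful on inertia (`eq_one_of_residue_eq_one`), so inertia has at most
one involution. No reflection in use can lie in inertia: it would equal its conjugate by `σ` and
commute with it. Hence `τ` and `τσ` both induce the unique involution of the finite residue field,
and `σ` lies in inertia.

The tame character of `σ` is then a primitive `m`-th root of unity, which lifts by Hensel to `ρ`;
the relation `στσ = τ` forces `τρ = ρ⁻¹`. Averaging produces a uniformizer `α` with `σα = ρα` and
`τα = α`, so `α ^ m` lies in `K₀`, and comparing valuations gives `α ^ m = uπ` with `u` a unit of
`K₀`. As Frobenius inverts the residue of `ρ`, `m` divides `q + 1`, so every element of the small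
residue field is an `m`-th power in the large one; Hensel extracts an `m`-th root of `u`, and
dividing `α` by it gives an `m`-th root of `π`.

The converse holds over any field: an automorphism is determined by its values in `{ρ, ρ⁻¹}` and `{ρ
^ i * α}`, and since there are `2m` automorphisms, every pair of values occurs. -/

/-! ### The valuation ring of a finite extension of a local field -/

open scoped NormedField in
theorem NormedField.valuationSubring_isDiscreteValuationRing (L : Type*)
    [NontriviallyNormedField L] [IsUltrametricDist L] [ProperSpace L] :
    IsDiscreteValuationRing (valuation (K := L)).valuationSubring ∧
    Finite (IsLocalRing.ResidueField (valuation (K := L)).valuationSubring) ∧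
    HenselianRing (valuation (K := L)).valuationSubring
      (IsLocalRing.maximalIdeal (valuation (K := L)).valuationSubring) := by
  let _ : (Valued.v (R := L)).RankOne := inferInstanceAs (valuation (K := L)).RankOne
  have hc : CompactSpace (Valued.integer L) := isCompact_iff_compactSpace.mp <| by
    convert isCompact_closedBall (0 : L) 1 using 1
    ext x
    simp [Valued.integer.mem_iff]
  have h :=
    (Valued.integer.compactSpace_iff_completeSpace_and_isDiscreteValuationRing_and_finite_residueField (K := L)).mp hc
  have hdvr : IsDiscreteValuationRing (valuation (K := L)).valuationSubring := h.2.1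
  let B := (valuation (K := L)).valuationSubring
  have hc' : CompactSpace B := hc
  let I := IsLocalRing.maximalIdeal B
  have hIc (n : ℕ) : IsClosed ((I ^ n : Ideal B) : Set B) := IsNoetherianRing.isClosed_ideal _
  have : IsAdicComplete I B :=
   { prec' f hf := by
      -- The cosets `f n + I ^ n` are nonempty, compact and decreasing; a point common to all of
      -- them is the adic limit.
      let S n : Set B := (fun x => x - f n) ⁻¹' ((I ^ n : Ideal B) : Set B)
      have hmem n x : x ∈ S n ↔ x - f n ∈ I ^ n := Iff.rfl
      have hS n : S (n + 1) ⊆ S n := by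
        intro x hx
        rw [hmem] at hx ⊢
        have h1 := hf n.le_succ
        rw [SModEq.sub_mem, smul_eq_mul, Ideal.mul_top] at h1
        have := sub_mem (Ideal.pow_le_pow_right n.le_succ hx) h1
        convert this using 1
        ring
      have h n : IsClosed (S n) := (hIc n).preimage (continuous_id.sub continuous_const)
      obtain ⟨x, hx⟩ := (h 0).isCompact.nonempty_iInter_of_sequence_nonempty_isCompact_isClosed S hS
        (fun n => ⟨f n, by simp [hmem]⟩) h
      refine ⟨x, fun n ↦ ?_⟩
      have := Set.mem_iInter.mp hx n
      rw [hmem] at this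
      rw [SModEq.sub_mem, smul_eq_mul, Ideal.mul_top, ← neg_mem_iff]
      simpa using this }
  exact ⟨hdvr, h.2.2, IsAdicComplete.henselianRing B I⟩

/-- The unit ball of the spectral norm works: this norm extends that of `K` and is unchanged by
`K`-automorphisms. -/
theorem IsNonarchimedeanLocalField.exists_invariant_valuationSubring (K : Type*) [Field K]
    [ValuativeRel K] [TopologicalSpace K] [IsNonarchimedeanLocalField K]
    (L : Type*) [Field L] [Algebra K L] [FiniteDimensional K L] :
    ∃ B : ValuationSubring L, IsDiscreteValuationRing B ∧
      Finite (IsLocalRing.ResidueField B) ∧ HenselianRing B (IsLocalRing.maximalIdeal B) ∧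
      (∀ x : K, algebraMap K L x ∈ B ↔ x ∈ 𝒪[K]) ∧
      ∀ (g : L ≃ₐ[K] L) (x : L), x ∈ B → g x ∈ B := by
  let _ := IsTopologicalAddGroup.rightUniformSpace K
  have := isUniformAddGroup_of_addCommGroup (G := K)
  let _ : (Valued.v (R := K)).RankOne :=
  { hom' := ValuativeRel.IsRankLeOne.nonempty.some.emb (R := K).comp
      MonoidWithZeroHom.ValueGroup₀.embedding
    strictMono' := ValuativeRel.IsRankLeOne.nonempty.some.strictMono.comp
        MonoidWithZeroHom.ValueGroup₀.embedding_strictMono }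
  let _ := Valued.toNontriviallyNormedField K (ValuativeRel.ValueGroupWithZero K)
  have : ProperSpace K := .of_nontriviallyNormedField_of_weaklyLocallyCompactSpace K
  let _ := spectralNorm.nontriviallyNormedField K L
  let _ := spectralNorm.normedAlgebra K L
  have : IsUltrametricDist L :=
    IsUltrametricDist.isUltrametricDist_of_isNonarchimedean_norm isNonarchimedean_spectralNorm
  have : ProperSpace L := FiniteDimensional.proper K L
  have h := NormedField.valuationSubring_isDiscreteValuationRing L
  refine ⟨NormedField.valuation.valuationSubring, h.1, h.2.1, h.2.2, fun x => ?_, fun g x => ?_⟩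
  · trans spectralNorm K L (algebraMap K L x) ≤ 1
    · exact Iff.rfl
    · rw [spectralNorm_extends]
      exact Valued.toNormedField.norm_le_one_iff
  · intro hx
    change spectralNorm K L (g x) ≤ 1
    rw [← spectralNorm_eq_of_equiv]
    exact hx

/-! ### Tame inertia and its involutions -/

/-- Every automorphism is linear over the prime field, and the Galois group over it is cyclic, so `a
^ 2 = 1` has at most two solutions. -/
theorem RingAut.eq_of_sq_eq_one {k : Type*} [Field k] [Finite k] {f g : k ≃+* k}
    (hf : f ^ 2 = 1) (hg : g ^ 2 = 1) (hf1 : f ≠ 1) (hg1 : g ≠ 1) : f = g := by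
  obtain ⟨p, hp⟩ := CharP.exists k
  have hpp : Fact p.Prime := ⟨CharP.char_is_prime k p⟩
  let _ := ZMod.algebra k p
  have key (f : k ≃+* k) : ∃ F : k ≃ₐ[ZMod p] k, ∀ x, F x = f x :=
    ⟨AlgEquiv.ofRingEquiv (f := f) fun x =>
      congrArg (fun φ : ZMod p →+* k => φ x)
        (Subsingleton.elim ((f : k →+* k).comp (algebraMap (ZMod p) k)) (algebraMap _ _)),
      fun _ => rfl⟩
  obtain ⟨F, hF⟩ := key f
  obtain ⟨F', hF'⟩ := key g
  classical
  have := Fintype.ofFinite (k ≃ₐ[ZMod p] k)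
  have hc := IsCyclic.card_pow_eq_one_le (α := k ≃ₐ[ZMod p] k) (n := 2) two_pos
  by_contra hne
  have h1 : F ≠ 1 := fun h => hf1 <| by
    ext x
    rw [← hF, h]
    rfl
  have h2 : F' ≠ 1 := fun h => hg1 <| by
    ext x
    rw [← hF', h]
    rfl
  have h3 : F ≠ F' := fun h => hne <| by
    ext x
    rw [← hF, h, hF']
  have h4 : F ^ 2 = 1 := by
    ext x
    simpa [pow_two, hF] using DFunLike.congr_fun hf x
  have h5 : F' ^ 2 = 1 := by
    ext x
    simpa [pow_two, hF'] using DFunLike.congr_fun hg x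
  have h6 : ({1, F, F'} : Finset (k ≃ₐ[ZMod p] k)) ⊆ Finset.univ.filter fun a => a ^ 2 = 1 := by
    intro a ha
    simp only [Finset.mem_insert, Finset.mem_singleton] at ha
    rcases ha with rfl | rfl | rfl <;> simp [h4, h5]
  have h7 := Finset.card_le_card h6
  rw [Finset.card_insert_of_notMem (by simp [h1.symm, h2.symm]), Finset.card_pair h3] at h7
  omega

namespace IsDiscreteValuationRing

open IsLocalRing

variable {B : Type*} [CommRing B] [IsDomain B] [IsDiscreteValuationRing B]
  {G : Type*} [Group G] [MulSemiringAction G B]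

theorem exists_smul_eq_mul (g : G) {ϖ : B} (hϖ : Irreducible ϖ) :
    ∃ c : B, IsUnit c ∧ g • ϖ = c * ϖ := by
  have h : Irreducible (g • ϖ) :=
    (MulEquiv.irreducible_iff (MulSemiringAction.toRingEquiv G B g)).mpr hϖ
  obtain ⟨u, hu⟩ := associated_of_irreducible B hϖ h
  exact ⟨u, u.isUnit, by rw [← hu, mul_comm]⟩

/-- On inertia the cocycle `g ↦ gϖ/ϖ` becomes multiplicative after reduction; this is the tame
character. -/
theorem exists_pow_smul_eq_mul {g : G} (hg : ∀ x : ResidueField B, g • x = x) {ϖ c : B}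
    (hc : g • ϖ = c * ϖ) (i : ℕ) :
    ∃ d : B, g ^ i • ϖ = d * ϖ ∧ residue B d = residue B c ^ i := by
  induction i with
  | zero => exact ⟨1, by simp⟩
  | succ i ih =>
    obtain ⟨d, hd, hd'⟩ := ih
    refine ⟨(g • d) * c, ?_, ?_⟩
    · rw [pow_succ', mul_smul, hd, smul_mul', hc, mul_assoc]
    · rw [map_mul, ResidueField.residue_smul, hg, hd', pow_succ]

/-- The Lagrange resolvent `∑ ρ⁻ⁱ gⁱϖ` is an eigenvector. Each term is `ϖ` times an element reducing
to `1`, so the sum is `ϖ` times an element reducing to `n`, a unit. -/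
theorem exists_smul_mul_eq_mul {g : G} {n : ℕ} (hn : g ^ n = 1) (hnu : IsUnit (n : B))
    (hg : ∀ x : ResidueField B, g • x = x) {ϖ ρ c : B} (hρ : ρ ^ n = 1)
    (hgρ : g • ρ = ρ) (hc : g • ϖ = c * ϖ) (hcρ : residue B c = residue B ρ) :
    ∃ w : B, IsUnit w ∧ g • (w * ϖ) = ρ * (w * ϖ) := by
  have hn0 : n ≠ 0 := by
    rintro rfl
    simp at hnu
  -- `ρ ^ (n - 1)` serves as `ρ⁻¹` throughout.
  have hρ' : ρ * ρ ^ (n - 1) = 1 := by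
    rw [← pow_succ', Nat.sub_add_cancel (Nat.one_le_iff_ne_zero.mpr hn0), hρ]
  have hC := exists_pow_smul_eq_mul hg hc
  rw [hcρ] at hC
  choose d hd hd' using hC
  let f : ℕ → B := fun i => (ρ ^ (n - 1)) ^ i * g ^ i • ϖ
  have hf (i : ℕ) : g • f i = ρ * f (i + 1) := by
    simp only [f, smul_mul', smul_pow', hgρ, ← mul_smul, ← pow_succ' g]
    rw [pow_succ' (ρ ^ (n - 1)), ← mul_assoc, ← mul_assoc, hρ', one_mul]
  have hsum : ∑ i ∈ Finset.range n, f (i + 1) = ∑ i ∈ Finset.range n, f i := by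
    have h := Finset.sum_range_succ f n
    rw [Finset.sum_range_succ'] at h
    have h0 : f n = f 0 := by simp [f, hn, ← pow_mul, mul_comm _ n, pow_mul ρ n, hρ]
    rwa [h0, add_left_inj] at h
  have hw : (∑ i ∈ Finset.range n, (ρ ^ (n - 1)) ^ i * d i) * ϖ = ∑ i ∈ Finset.range n, f i := by
    simp only [Finset.sum_mul, f, hd, mul_assoc]
  refine ⟨∑ i ∈ Finset.range n, (ρ ^ (n - 1)) ^ i * d i, ?_, ?_⟩
  · rw [← residue_ne_zero_iff_isUnit] at hnu ⊢
    convert hnu using 1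
    simp only [map_sum, map_mul, map_pow, hd', ← mul_pow]
    simp only [← map_pow, ← map_mul, mul_comm _ ρ, hρ']
    simp
  · rw [hw, Finset.smul_sum, Finset.sum_congr rfl fun i _ => hf i, ← Finset.mul_sum, hsum]

/-- Faithfulness of the tame character. With a uniformizer `α` fixed by `g`, subtracting the sum
over powers of `g` from `n * b` leaves `α * d`, so `n (gb - b) = α (gd - d)`. Iterating, `gb - b` is
divisible by every power of `α`. -/
theorem eq_one_of_residue_eq_one [FaithfulSMul G B] {g : G} {n : ℕ} (hn : g ^ n = 1)
    (hnu : IsUnit (n : B)) (hg : ∀ x : ResidueField B, g • x = x) {ϖ c : B} (hϖ : Irreducible ϖ)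
    (hc : g • ϖ = c * ϖ) (hc1 : residue B c = 1) : g = 1 := by
  obtain ⟨w, hw, hgw⟩ := exists_smul_mul_eq_mul hn hnu hg (one_pow n) (smul_one g) hc
    (by rw [hc1, map_one])
  set α := w * ϖ with hα
  rw [one_mul] at hgw
  have hαi : Irreducible α := (irreducible_isUnit_mul hw).mpr hϖ
  have key (j : ℕ) : ∀ b : B, α ^ j ∣ g • b - b := by
    induction j with
    | zero => simp
    | succ j ih =>
      intro b
      have hS : g • ∑ i ∈ Finset.range n, g ^ i • b = ∑ i ∈ Finset.range n, g ^ i • b := by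
        have h := Finset.sum_range_succ (fun i => g ^ i • b) n
        rw [Finset.sum_range_succ', hn, pow_zero, add_left_inj] at h
        rw [Finset.smul_sum, ← h]
        simp only [← mul_smul, ← pow_succ']
      have hmem : (n : B) * b - ∑ i ∈ Finset.range n, g ^ i • b ∈ IsLocalRing.maximalIdeal B := by
        rw [← residue_eq_zero_iff, map_sub, map_sum]
        have (i : ℕ) : g ^ i • residue B b = residue B b := by
          induction i with
          | zero => simp
          | succ i ih => rw [pow_succ, mul_smul, hg, ih]
        simp [this]
      rw [hαi.maximalIdeal_eq, Ideal.mem_span_singleton] at hmem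
      obtain ⟨d, hd⟩ := hmem
      obtain ⟨e, he⟩ := ih d
      rw [← hnu.dvd_mul_left]
      refine ⟨e, ?_⟩
      have h := congrArg (g • ·) hd
      simp only [smul_sub, hS, smul_mul', hgw] at h
      have hgn : g • (n : B) = n := map_natCast (MulSemiringAction.toRingHom G B g) n
      rw [hgn] at h
      calc (n : B) * (g • b - b) = α * (g • d - d) := by linear_combination h - hd
        _ = _ := by rw [he]; ring
  refine eq_of_smul_eq_smul fun b : B => ?_
  rw [one_smul]
  by_contra hne
  obtain ⟨k, u, hk⟩ := eq_unit_mul_pow_irreducible (sub_ne_zero.mpr hne) hαi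
  have h := key (k + 1) b
  rw [hk, u.isUnit.dvd_mul_left, pow_dvd_pow_iff hαi.ne_zero hαi.not_isUnit] at h
  omega

/-- A tamely acting inertia group has at most one involution. -/
theorem eq_of_mul_self_eq_one [FaithfulSMul G B] [Finite G] (hG : IsUnit ((Nat.card G : ℕ) : B))
    (h2 : IsUnit (2 : B))
    {g h : G} (hg : ∀ x : ResidueField B, g • x = x) (hh : ∀ x : ResidueField B, h • x = x)
    (hgg : g * g = 1) (hhh : h * h = 1) (hg1 : g ≠ 1) (hh1 : h ≠ 1) : g = h := by
  obtain ⟨ϖ, hϖ⟩ := exists_irreducible B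
  -- The tame character of an inertial involution squares to `1` and is not `1`, hence is `-1`.
  have key {g : G} (hg : ∀ x : ResidueField B, g • x = x) (hgg : g * g = 1) (hg1 : g ≠ 1) :
      ∃ c, g • ϖ = c * ϖ ∧ residue B c = -1 := by
    obtain ⟨c, -, hc⟩ := exists_smul_eq_mul g hϖ
    refine ⟨c, hc, ?_⟩
    have h1 : (g • c) * c = 1 := by
      apply mul_right_cancel₀ hϖ.ne_zero
      rw [mul_assoc, ← hc, ← smul_mul', ← hc, ← mul_smul, hgg, one_smul, one_mul]
    have h3 := congrArg (residue B) h1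
    rw [map_mul, ResidueField.residue_smul, hg, map_one, mul_self_eq_one_iff] at h3
    exact h3.resolve_left fun h => hg1 <|
      eq_one_of_residue_eq_one (n := 2) (by rw [pow_two, hgg]) (by exact_mod_cast h2) hg hϖ hc h
  obtain ⟨c, hc, hc'⟩ := key hg hgg hg1
  obtain ⟨d, hd, hd'⟩ := key hh hhh hh1
  have : g * h = 1 := eq_one_of_residue_eq_one (pow_card_eq_one' (x := g * h)) hG
    (fun x => by rw [mul_smul, hh, hg]) hϖ (c := (g • d) * c)
    (by rw [mul_smul, hd, smul_mul', hc, mul_assoc])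
    (by rw [map_mul, ResidueField.residue_smul, hg, hc', hd']; ring)
  rw [← hhh] at this
  exact mul_right_cancel this

/-- The rotations of a tame dihedral Galois group lie in the inertia group. -/
theorem smul_residue_eq_of_dihedral [Finite (ResidueField B)] [FaithfulSMul G B] [Finite G]
    (hG : IsUnit ((Nat.card G : ℕ) : B)) (h2 : IsUnit (2 : B)) {σ τ : G}
    (hτ : τ * τ = 1) (hτσ : τ * σ = σ⁻¹ * τ) (hσ : σ * σ ≠ 1) (x : ResidueField B) :
    σ • x = x := by
  have hτσ2 : (τ * σ) * (τ * σ) = 1 := by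
    calc (τ * σ) * (τ * σ) = σ⁻¹ * (τ * τ) * σ := by rw [hτσ]; simp only [mul_assoc, hτσ]
      _ = 1 := by rw [hτ]; group
  have hne : τ * σ ≠ σ * τ := fun h => hσ <| by
    rw [hτσ] at h
    exact mul_eq_one_iff_eq_inv.mpr (mul_right_cancel h).symm
  -- Conjugation by `σ` preserves inertia, so an inertial involution, being unique, commutes with
  -- `σ`.
  have conj {g : G} (hg : ∀ x : ResidueField B, g • x = x) (hgg : g * g = 1) :
      g = σ * g * σ⁻¹ := by
    by_cases hg1 : g = 1
    · simp [hg1]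
    · refine eq_of_mul_self_eq_one hG h2 hg (fun x => ?_) hgg ?_ hg1 ?_
      · rw [mul_smul, mul_smul, hg, smul_inv_smul]
      · calc σ * g * σ⁻¹ * (σ * g * σ⁻¹) = σ * (g * g) * σ⁻¹ := by group
          _ = 1 := by rw [hgg]; group
      · simpa [mul_inv_eq_one] using hg1
  let φ : G →* RingAut (ResidueField B) := MulSemiringAction.toRingAut G (ResidueField B)
  have hφ {g : G} (hg : φ g = 1) (x : ResidueField B) : g • x = x := DFunLike.congr_fun hg x
  have h1 : φ τ ≠ 1 := fun h => hne <| by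
    have := conj (hφ h) hτ
    rw [eq_mul_inv_iff_mul_eq] at this
    exact this
  have h2 : φ (τ * σ) ≠ 1 := fun h => hne <| by
    have := conj (hφ h) hτσ2
    rw [this]
    group
  refine hφ ?_ x
  have := RingAut.eq_of_sq_eq_one (f := φ τ) (g := φ (τ * σ))
    (by rw [pow_two, ← map_mul, hτ, map_one]) (by rw [pow_two, ← map_mul, hτσ2, map_one]) h1 h2
  rw [map_mul] at this
  simpa using this

end IsDiscreteValuationRing

/-! ### Hensel lifting and an equivariant uniformizer -/

namespace IsLocalRing

open Polynomial

variable {B : Type*} [CommRing B] [IsLocalRing B]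

theorem exists_pow_eq_of_residue_pow_eq [HenselianRing B (maximalIdeal B)] {n : ℕ}
    (hn : IsUnit (n : B)) {u : B} (hu : IsUnit u) {a : ResidueField B}
    (ha : a ^ n = residue B u) : ∃ v : B, v ^ n = u ∧ residue B v = a := by
  obtain ⟨b, rfl⟩ := residue_surjective a
  have hn0 : n ≠ 0 := by
    rintro rfl
    simp at hn
  have hb : residue B b ≠ 0 := by
    intro h
    rw [h, zero_pow hn0] at ha
    exact (residue_ne_zero_iff_isUnit u).mpr hu ha.symm
  obtain ⟨v, hv, hv'⟩ := HenselianRing.is_henselian (I := maximalIdeal B) (X ^ n - C u)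
    (monic_X_pow_sub_C u hn0) b
    (by rw [← residue_eq_zero_iff]; simp [ha])
    (by
      apply IsUnit.map
      rw [residue_ne_zero_iff_isUnit] at hb
      simpa [derivative_X_pow, -IsUnit.mul_iff] using hn.mul (hb.pow (n - 1)))
  refine ⟨v, by simpa [sub_eq_zero] using hv, ?_⟩
  rwa [← sub_eq_zero, ← map_sub, residue_eq_zero_iff]

theorem eq_of_pow_eq_of_residue_eq {n : ℕ} (hn : IsUnit (n : B)) {a b : B} (ha : IsUnit a)
    (hab : a ^ n = b ^ n) (h : residue B a = residue B b) : a = b := by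
  refine eq_of_eval_eq_zero_of_not_isUnit_sub (f := X ^ n - C (a ^ n)) (by simp) (by simp [hab]) ?_
    (by simpa [derivative_X_pow, -map_pow, -IsUnit.mul_iff] using hn.mul (ha.pow (n - 1)))
  rw [← residue_ne_zero_iff_isUnit, map_sub, h, sub_self, not_not]

end IsLocalRing

namespace IsDiscreteValuationRing

open IsLocalRing

variable {B : Type*} [CommRing B] [IsDomain B] [IsDiscreteValuationRing B]
  {G : Type*} [Group G] [MulSemiringAction G B]

/-- In a tame dihedral extension, rotations act on some uniformizer fixed by a reflection through
a root of unity which the reflection inverts. -/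
theorem exists_isPrimitiveRoot_irreducible [Finite (ResidueField B)]
    [HenselianRing B (IsLocalRing.maximalIdeal B)] [FaithfulSMul G B] [Finite G]
    (hG : IsUnit ((Nat.card G : ℕ) : B)) (h2 : IsUnit (2 : B)) {σ τ : G}
    (hτ : τ * τ = 1) (hτσ : τ * σ = σ⁻¹ * τ) {m : ℕ} (hm : 3 ≤ m) (hσ : orderOf σ = m) :
    ∃ ρ α : B, ρ ^ m = 1 ∧ IsPrimitiveRoot (residue B ρ) m ∧ σ • ρ = ρ ∧ ρ * τ • ρ = 1 ∧
      Irreducible α ∧ σ • α = ρ * α ∧ τ • α = α := by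
  have hσσ : σ * σ ≠ 1 := by
    rw [← pow_two]
    intro h
    have := Nat.le_of_dvd two_pos (hσ ▸ orderOf_dvd_of_pow_eq_one h)
    omega
  have hσm : σ ^ m = 1 := hσ ▸ pow_orderOf_eq_one σ
  have hmu : IsUnit (m : B) := by
    refine isUnit_of_dvd_unit (Nat.cast_dvd_cast ?_) hG
    rw [← hσ]
    exact orderOf_dvd_natCard σ
  have hI := smul_residue_eq_of_dihedral hG h2 hτ hτσ hσσ
  obtain ⟨ϖ, hϖ⟩ := exists_irreducible B
  obtain ⟨c, hcu, hc⟩ := exists_smul_eq_mul σ hϖ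
  have hprim : IsPrimitiveRoot (residue B c) m := by
    refine ⟨?_, fun l hl => ?_⟩
    · obtain ⟨d, hd, hd'⟩ := exists_pow_smul_eq_mul hI hc m
      rw [← hd']
      rw [hσm, one_smul] at hd
      rw [← map_one (residue B)]
      congr 1
      apply mul_right_cancel₀ hϖ.ne_zero
      rw [← hd, one_mul]
    · obtain ⟨d, hd, hd'⟩ := exists_pow_smul_eq_mul hI hc l
      rw [← hσ]
      refine orderOf_dvd_of_pow_eq_one
        (eq_one_of_residue_eq_one (n := m) ?_ hmu (fun x => ?_) hϖ hd (hd'.trans hl))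
      · rw [← pow_mul, mul_comm, pow_mul, hσm, one_pow]
      · have (i : ℕ) : σ ^ i • x = x := by
          induction i with
          | zero => simp
          | succ i ih => rw [pow_succ, mul_smul, hI, ih]
        exact this l
  obtain ⟨ρ, hρ, hρc⟩ := exists_pow_eq_of_residue_pow_eq (n := m) hmu isUnit_one
    (a := residue B c) (by rw [hprim.pow_eq_one, map_one])
  have hρu : IsUnit ρ := IsUnit.of_pow_eq_one hρ (by omega)
  have hσρ : σ • ρ = ρ := eq_of_pow_eq_of_residue_eq hmu (hρu.map (MulSemiringAction.toRingHom G B σ))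
    (by rw [← smul_pow', hρ, smul_one]) (by rw [ResidueField.residue_smul, hI])
  have hτρ : ρ * τ • ρ = 1 := by
    refine eq_of_pow_eq_of_residue_eq hmu (hρu.mul (hρu.map (MulSemiringAction.toRingHom G B τ)))
      (by rw [mul_pow, ← smul_pow', hρ, smul_one, one_mul, one_pow]) ?_
    rw [map_mul, ResidueField.residue_smul, hρc, ← ResidueField.residue_smul, map_one]
    -- Evaluating `στσ = τ` on `ϖ` and reducing, where `σ` acts trivially, shows that `τ` inverts
    -- the residue of `c`.
    obtain ⟨d, hd, hτϖ⟩ := exists_smul_eq_mul τ hϖ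
    have h1 : σ • τ • σ • ϖ = τ • ϖ := by
      rw [← mul_smul τ, hτσ, mul_smul, smul_inv_smul]
    rw [hc, smul_mul', smul_mul', hτϖ, smul_mul', hc] at h1
    have h2 : (σ • τ • c) * (σ • d) * c = d := by
      apply mul_right_cancel₀ hϖ.ne_zero
      rw [← h1]
      ring
    have h3 := congrArg (residue B) h2
    simp only [map_mul, ResidueField.residue_smul, hI] at h3
    apply mul_right_cancel₀ ((residue_ne_zero_iff_isUnit d).mpr hd)
    rw [ResidueField.residue_smul, one_mul]
    linear_combination h3
  rw [← hρc] at hprim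
  obtain ⟨w, hw, hα⟩ := exists_smul_mul_eq_mul hσm hmu hI hρ hσρ hc hρc.symm
  have hαi : Irreducible (w * ϖ) := (irreducible_isUnit_mul hw).mpr hϖ
  generalize w * ϖ = α at hα hαi
  obtain ⟨d, hd, hτα⟩ := exists_smul_eq_mul τ hαi
  have hστα : σ • τ • α = ρ * τ • α := by
    have h1 : σ • τ • σ • α = τ • α := by
      rw [← mul_smul τ, hτσ, mul_smul, smul_inv_smul]
    rw [hα, smul_mul', smul_mul'] at h1
    have h2 : ρ * σ • τ • ρ = 1 := by
      have := congrArg (σ • ·) hτρ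
      simpa [smul_mul', hσρ] using this
    linear_combination ρ * h1 - (σ • τ • α) * h2
  -- The trace of `b * α` under `τ` is fixed by `τ` and, as `σ` scales both terms by `ρ`, remains an
  -- eigenvector. The residue condition makes it a uniformizer. Taking `b = 1` works unless `d`
  -- reduces to `-1`; then `b = ρ` works, because `ρ` and `ρ⁻¹` differ modulo the maximal ideal for
  -- `m ≥ 3`.
  have key (b : B) (hb : σ • b = b) (hτb : σ • τ • b = τ • b)
      (hbd : residue B b + residue B (τ • b) * residue B d ≠ 0) :
      ∃ α, Irreducible α ∧ σ • α = ρ * α ∧ τ • α = α := by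
    refine ⟨b * α + τ • (b * α), ?_, ?_, ?_⟩
    · rw [smul_mul', hτα, ← mul_assoc, ← add_mul]
      refine (irreducible_isUnit_mul ?_).mpr hαi
      rw [← residue_ne_zero_iff_isUnit]
      simpa using hbd
    · rw [smul_add, smul_mul', smul_mul', smul_mul', hστα, hα, hb, hτb]
      ring
    · rw [smul_add, ← mul_smul τ τ, hτ, one_smul, add_comm]
  refine ⟨ρ, ?_⟩
  by_cases h1 : 1 + residue B d = 0
  · have h2 : σ • τ • ρ = τ • ρ := by
      apply hρu.mul_left_cancel
      have := congrArg (σ • ·) hτρ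
      simp only [smul_mul', hσρ, smul_one] at this
      rw [this, hτρ]
    have h3 : residue B ρ + residue B (τ • ρ) * residue B d ≠ 0 := by
      rw [eq_neg_of_add_eq_zero_right h1]
      intro h
      have h3 := congrArg (residue B) hτρ
      rw [map_mul, map_one] at h3
      have h4 : residue B ρ ^ 2 = 1 := by linear_combination h3 + residue B ρ * h
      have := Nat.le_of_dvd two_pos (hprim.dvd_of_pow_eq_one _ h4)
      omega
    obtain ⟨α, h⟩ := key ρ hσρ h2 h3
    exact ⟨α, hρ, hprim, hσρ, hτρ, h⟩
  · obtain ⟨α, h⟩ := key 1 (smul_one _) (by simp) (by simpa using h1)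
    exact ⟨α, hρ, hprim, hσρ, hτρ, h⟩

end IsDiscreteValuationRing

/-! ### Powers in finite fields -/

theorem IsCyclic.exists_pow_eq_of_pow_eq_one {C : Type*} [Group C] [Finite C] [IsCyclic C]
    {m l : ℕ} (h : m * l ∣ Nat.card C) (hl : l ≠ 0) {x : C} (hx : x ^ l = 1) :
    ∃ y : C, y ^ m = x := by
  obtain ⟨g, hg⟩ := IsCyclic.exists_generator (α := C)
  obtain ⟨i, rfl⟩ := (mem_powers_iff_mem_zpowers (x := g)).mpr (hg x)
  dsimp only at hx ⊢
  rw [← pow_mul] at hx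
  have h1 := orderOf_dvd_of_pow_eq_one hx
  rw [orderOf_eq_card_of_forall_mem_zpowers hg] at h1
  obtain ⟨j, rfl⟩ := Nat.dvd_of_mul_dvd_mul_right (Nat.pos_of_ne_zero hl) (h.trans h1)
  exact ⟨g ^ j, by rw [← pow_mul, mul_comm]⟩

/-- If an automorphism of `k` over `κ` inverts a primitive `m`-th root of unity, then every element
of `κ` is an `m`-th power in `k`. -/
theorem FiniteField.exists_pow_eq_algebraMap {κ k : Type*} [Field κ] [Field k] [Finite k]
    [Algebra κ k] (f : k ≃ₐ[κ] k) {ρ : k} {m : ℕ} (hρ : IsPrimitiveRoot ρ m) (hm : 3 ≤ m)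
    (hf : ρ * f ρ = 1) {t : κ} (ht : algebraMap κ k t = ρ + f ρ) {u : κ} (hu : u ≠ 0) :
    ∃ y : k, y ^ m = algebraMap κ k u := by
  have := Finite.of_injective _ (algebraMap κ k).injective
  have := Fintype.ofFinite κ
  have := Fintype.ofFinite k
  set q := Fintype.card κ with hq
  let φ := frobeniusAlgEquivOfAlgebraic κ k
  have hφ (x : k) : φ x = x ^ q := rfl
  have hne : f ρ ≠ ρ := fun h => by
    rw [h, ← pow_two] at hf
    have := Nat.le_of_dvd two_pos (hρ.dvd_of_pow_eq_one _ hf)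
    omega
  -- `f` is a power of Frobenius, so Frobenius cannot fix `ρ` if `f` moves it.
  have hρφ : φ ρ ≠ ρ := fun h => hne <| by
    obtain ⟨n, hn⟩ := (bijective_frobeniusAlgEquivOfAlgebraic_pow κ k).2 f
    have hn' (i : ℕ) : (φ ^ i) ρ = ρ := by
      induction i with
      | zero => rfl
      | succ i ih => rw [pow_succ, AlgEquiv.mul_apply, h, ih]
    rw [← hn]
    exact hn' n
  have hφf : φ ρ = f ρ := by
    have h1 : φ ρ * φ (f ρ) = 1 := by rw [← map_mul, hf, map_one]
    have h2 : φ ρ + φ (f ρ) = ρ + f ρ := by rw [← map_add, ← ht, AlgEquiv.commutes]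
    -- Frobenius permutes the roots `ρ`, `f ρ` of `X² - tX + 1`.
    have h3 : (φ ρ - ρ) * (φ ρ - f ρ) = 0 := by linear_combination φ ρ * h2 - h1 + hf
    exact sub_eq_zero.mp ((mul_eq_zero.mp h3).resolve_left (sub_ne_zero.mpr hρφ))
  have hρq : ρ ^ (q + 1) = 1 := by rw [pow_succ', ← hφ, hφf, hf]
  have hmq := hρ.dvd_of_pow_eq_one _ hρq
  have hinv : f ρ = ρ⁻¹ := eq_inv_of_mul_eq_one_right hf
  set d := Module.finrank κ k
  have hcard : Fintype.card k = q ^ d := Module.card_eq_pow_finrank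
  -- Even powers of Frobenius fix `ρ`, and the `d`-th power is the identity; for odd `d` it would
  -- invert `ρ`.
  have heven : Even d := by
    by_contra hodd
    rw [Nat.not_even_iff_odd] at hodd
    have hi (i : ℕ) : ρ ^ q ^ (2 * i) = ρ := by
      induction i with
      | zero => simp
      | succ i ih =>
        rw [show 2 * (i + 1) = 2 * i + 1 + 1 by ring, pow_succ, pow_succ, pow_mul, pow_mul, ih,
          ← hφ ρ, hφf, hinv, inv_pow, ← hφ ρ, hφf, hinv, inv_inv]
    obtain ⟨i, hi'⟩ := hodd
    have h := FiniteField.pow_card ρ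
    rw [hcard, hi', pow_succ, pow_mul, hi, ← hφ, hφf] at h
    exact hne h
  have hq1 : 1 < q := Fintype.one_lt_card
  -- `m ∣ q + 1`, and `(q + 1)(q - 1) = q² - 1` divides `q ^ d - 1` for even `d`.
  have hdvd : m * (q - 1) ∣ Nat.card kˣ := by
    rw [Nat.card_units, Nat.card_eq_fintype_card, hcard]
    obtain ⟨i, hi⟩ := heven
    rw [hi, ← two_mul, pow_mul]
    refine (mul_dvd_mul_right hmq _).trans ?_
    rw [← Nat.sq_sub_sq]
    simpa using Nat.sub_dvd_pow_sub_pow (q ^ 2) 1 i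
  have hu' : algebraMap κ k u ≠ 0 := by simpa using hu
  obtain ⟨y, hy⟩ := IsCyclic.exists_pow_eq_of_pow_eq_one hdvd (by omega) (x := Units.mk0 _ hu') (by
    ext
    simp [← map_pow, hq, FiniteField.pow_card_sub_one_eq_one u hu])
  exact ⟨y, by simpa using congrArg Units.val hy⟩

/-! ### Dihedral extensions have the explicit form -/

theorem DihedralGroup.exists_rotation_reflection {G : Type*} [Group G] {n : ℕ} (hn : n ≠ 0)
    (e : G ≃* DihedralGroup n) :
    ∃ σ τ : G, orderOf σ = n ∧ τ * τ = 1 ∧ τ * σ = σ⁻¹ * τ ∧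
      ∀ g : G, ∃ i : ℕ, g = σ ^ i ∨ g = τ * σ ^ i := by
  have : NeZero n := ⟨hn⟩
  refine ⟨e.symm (r 1), e.symm (sr 0), ?_, ?_, ?_, fun g => ?_⟩
  · rw [MulEquiv.orderOf_eq, orderOf_r_one]
  · rw [← map_mul, sr_mul_self, map_one]
  · rw [← map_inv, ← map_mul, ← map_mul]
    simp
  · obtain ⟨x, rfl⟩ := e.symm.surjective g
    rcases x with i | i
    · refine ⟨i.val, .inl ?_⟩
      rw [← map_pow, r_one_pow, ZMod.natCast_zmod_val]
    · refine ⟨i.val, .inr ?_⟩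
      rw [← map_pow, r_one_pow, ← map_mul, sr_mul_r, ZMod.natCast_zmod_val, zero_add]

/-- The action of a Galois group on an invariant valuation subring. -/
abbrev ValuationSubring.galoisAction {K L : Type*} [Field K] [Field L] [Algebra K L]
    (B : ValuationSubring L) (hB : ∀ (g : L ≃ₐ[K] L) (x : L), x ∈ B → g x ∈ B) :
    MulSemiringAction (L ≃ₐ[K] L) B where
  smul g x := ⟨g x, hB g x x.2⟩
  one_smul _ := rfl
  mul_smul _ _ _ := rfl
  smul_zero g := Subtype.ext (map_zero g)
  smul_add g x y := Subtype.ext (map_add g (x : L) y)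
  smul_one g := Subtype.ext (map_one g)
  smul_mul g x y := Subtype.ext (map_mul g (x : L) y)

theorem isUnit_natCast_of_coprime_ringChar {A : Type*} [CommRing A] [IsLocalRing A] {n : ℕ}
    (h : n.Coprime (ringChar (IsLocalRing.ResidueField A))) : IsUnit (n : A) := by
  rw [← IsLocalRing.residue_ne_zero_iff_isUnit, map_natCast]
  intro h0
  have h1 := (ringChar.spec (IsLocalRing.ResidueField A) n).mp h0
  exact CharP.ringChar_ne_one (Nat.Coprime.eq_one_of_dvd h.symm h1)

/-- As `ρ` is not in `K`, its minimal polynomial is `X² - tX + 1`, whose degree and constant term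
give the two values. -/
theorem IsPrimitiveRoot.finrank_adjoin_and_norm {K L : Type*} [Field K] [Field L] [Algebra K L]
    {ρ ρ' : L} {t : K} (h1 : ρ * ρ' = 1) (h2 : ρ + ρ' = algebraMap K L t)
    (hne : ρ ∉ (⊥ : IntermediateField K L)) :
    Module.finrank K (IntermediateField.adjoin K {ρ}) = 2 ∧
      Algebra.norm K (IntermediateField.AdjoinSimple.gen K ρ) = 1 := by
  open Polynomial in
  have hdeg : (X ^ 2 - C t * X + C 1 : K[X]).natDegree = 2 := by compute_degree!
  have hmonic : (X ^ 2 - C t * X + C 1 : K[X]).Monic := by monicity!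
  have hroot : aeval ρ (X ^ 2 - C t * X + C 1 : K[X]) = 0 := by
    simp only [map_add, map_sub, map_mul, aeval_C, map_pow, aeval_X, map_one, ← h2]
    linear_combination -h1
  have hint : IsIntegral K ρ := ⟨_, hmonic, hroot⟩
  have h2le : 2 ≤ (minpoly K ρ).natDegree := by
    rw [minpoly.two_le_natDegree_iff hint]
    exact hne
  have hmin : minpoly K ρ = X ^ 2 - C t * X + C 1 :=
    (eq_of_monic_of_dvd_of_natDegree_le (minpoly.monic hint) hmonic (minpoly.dvd K ρ hroot)
      (by rw [hdeg]; exact h2le)).symm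
  refine ⟨by rw [IntermediateField.adjoin.finrank hint, hmin, hdeg], ?_⟩
  have := Algebra.PowerBasis.norm_gen_eq_coeff_zero_minpoly
    (IntermediateField.adjoin.powerBasis hint)
  rw [IntermediateField.adjoin.powerBasis_gen, IntermediateField.minpoly_gen, hmin,
    IntermediateField.adjoin.powerBasis_dim, hmin, hdeg] at this
  rw [this]
  simp

theorem IsDihedralExtension.exists_isPrimitiveRoot {K₀ : Type*} [Field K₀] [ValuativeRel K₀]
    [TopologicalSpace K₀] [IsNonarchimedeanLocalField K₀]
    (m : ℕ) (hm : 3 ≤ m) (hchar : Nat.Coprime (2 * m) (ringChar 𝓀[K₀]))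
    {L : Type*} [Field L] [Algebra K₀ L] (hL : Module.finrank K₀ L = 2 * m)
    (π : 𝒪[K₀]) (hπ : Irreducible π) (hdih : IsDihedralExtension K₀ L) :
    ∃ ρ : L, IsPrimitiveRoot ρ m ∧
        Module.finrank K₀ (IntermediateField.adjoin K₀ {ρ}) = 2 ∧
        Algebra.norm K₀ (IntermediateField.AdjoinSimple.gen K₀ ρ) = 1 ∧
        ∃ α : L, α ^ m = algebraMap K₀ L (π : K₀) ∧
          IntermediateField.adjoin K₀ {ρ, α} = ⊤ := by
  obtain ⟨hGal, n, hn, ⟨e⟩⟩ := hdih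
  have : FiniteDimensional K₀ L := .of_finrank_pos (by omega)
  have hcard : Nat.card (L ≃ₐ[K₀] L) = 2 * m := by rw [IsGalois.card_aut_eq_finrank, hL]
  have hnm : n = m := by
    have := Nat.card_congr e.toEquiv
    rw [hcard, DihedralGroup.nat_card] at this
    omega
  subst hnm
  obtain ⟨σ, τ, hσ, hτ, hτσ, hgen⟩ := DihedralGroup.exists_rotation_reflection (by omega) e
  obtain ⟨B, hdvr, hfin, hhens, hBK, hBG⟩ :=
    IsNonarchimedeanLocalField.exists_invariant_valuationSubring K₀ L
  let _ := B.galoisAction hBG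
  have coe_smul (g : L ≃ₐ[K₀] L) (b : B) : ((g • b : B) : L) = g b := rfl
  have : FaithfulSMul (L ≃ₐ[K₀] L) B := ⟨fun {g h} hgh => by
    ext x
    obtain ⟨a, b, -, rfl⟩ := IsFractionRing.div_surjective (A := B) x
    rw [map_div₀, map_div₀]
    exact congrArg₂ (· / ·) (congrArg Subtype.val (hgh a)) (congrArg Subtype.val (hgh b))⟩
  let φ : 𝒪[K₀] →+* B :=
    ((algebraMap K₀ L).comp (Subring.subtype _)).codRestrict B.toSubring fun x => (hBK x).mpr x.2
  have hφ (x : 𝒪[K₀]) : ((φ x : B) : L) = algebraMap K₀ L x := rfl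
  have : IsLocalHom φ := ⟨fun a ha => by
    obtain ⟨b, hb⟩ := isUnit_iff_exists_inv.mp ha
    have ha0 : (a : K₀) ≠ 0 := by
      rintro h
      rw [show a = 0 from Subtype.ext h, map_zero, zero_mul] at hb
      exact zero_ne_one hb
    have hb' : (b : L) = algebraMap K₀ L (a : K₀)⁻¹ := by
      rw [map_inv₀]
      exact eq_inv_of_mul_eq_one_right (congrArg Subtype.val hb)
    exact isUnit_iff_exists_inv.mpr ⟨⟨(a : K₀)⁻¹, (hBK _).mp (hb' ▸ b.2)⟩,
      Subtype.ext (mul_inv_cancel₀ ha0)⟩⟩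
  have hφG (g : L ≃ₐ[K₀] L) (x : 𝒪[K₀]) : g • φ x = φ x := Subtype.ext (g.commutes x)
  have hfix (b : B) (h1 : σ • b = b) (h2 : τ • b = b) : ∃ a, φ a = b := by
    have hσi (i : ℕ) : σ ^ i • b = b := by
      induction i with
      | zero => simp
      | succ i ih => rw [pow_succ, mul_smul, h1, ih]
    have : (b : L) ∈ (⊥ : IntermediateField K₀ L) := by
      rw [IsGalois.mem_bot_iff_fixed]
      intro g
      rw [← coe_smul]
      obtain ⟨i, rfl | rfl⟩ := hgen g
      · rw [hσi]
      · rw [mul_smul, hσi, h2]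
    obtain ⟨a, ha⟩ := IntermediateField.mem_bot.mp this
    exact ⟨⟨a, (hBK a).mp (ha ▸ b.2)⟩, Subtype.ext ha⟩
  have h2m : IsUnit ((2 * n : ℕ) : B) := by
    have := (isUnit_natCast_of_coprime_ringChar hchar).map φ
    rwa [map_natCast] at this
  have hn_unit : IsUnit (n : B) := isUnit_of_dvd_unit (Nat.cast_dvd_cast ⟨2, mul_comm _ _⟩) h2m
  have h2u : IsUnit (2 : B) :=
    isUnit_of_dvd_unit (by exact_mod_cast Nat.cast_dvd_cast (Dvd.intro n rfl)) h2m
  have hI := IsDiscreteValuationRing.smul_residue_eq_of_dihedral (hcard ▸ h2m) h2u hτ hτσ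
    (fun h => by
      rw [← pow_two] at h
      have := Nat.le_of_dvd two_pos (hσ ▸ orderOf_dvd_of_pow_eq_one h)
      omega)
  obtain ⟨ρ, α, hρ, hρprim, hσρ, hτρ, hα, hσα, hτα⟩ :=
    IsDiscreteValuationRing.exists_isPrimitiveRoot_irreducible (hcard ▸ h2m) h2u hτ hτσ
      hm hσ
  have hρu : IsUnit ρ := IsUnit.of_pow_eq_one hρ (by omega)
  have hρB : IsPrimitiveRoot ρ n := ⟨hρ, fun l hl => hρprim.dvd_of_pow_eq_one l (by
    rw [← map_pow, hl, map_one])⟩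
  have hρL : IsPrimitiveRoot (ρ : L) n := hρB.map_of_injective (f := B.subtype) Subtype.val_injective
  have hτρne : τ • ρ ≠ ρ := fun h => by
    rw [h, ← pow_two] at hτρ
    have := Nat.le_of_dvd two_pos (hρB.dvd_of_pow_eq_one _ hτρ)
    omega
  obtain ⟨t, ht⟩ := hfix (ρ + τ • ρ)
    (by
      rw [smul_add, hσρ]
      congr 1
      apply hρu.mul_left_cancel
      have := congrArg (σ • ·) hτρ
      simp only [smul_mul', hσρ, smul_one] at this
      rw [this, hτρ])
    (by rw [smul_add, ← mul_smul, hτ, one_smul, add_comm])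
  obtain ⟨hfinrank, hnorm⟩ := IsPrimitiveRoot.finrank_adjoin_and_norm (K := K₀) (t := (t : K₀))
    (congrArg Subtype.val hτρ) (congrArg Subtype.val ht.symm) (fun h => hτρne <| by
      rw [IsGalois.mem_bot_iff_fixed] at h
      exact Subtype.ext (h τ))
  obtain ⟨a, ha⟩ := hfix (α ^ n) (by rw [smul_pow', hσα, mul_pow, hρ, one_mul])
    (by rw [smul_pow', hτα])
  have ha0 : a ≠ 0 := by
    rintro rfl
    rw [map_zero] at ha
    exact pow_ne_zero n hα.ne_zero ha.symm
  obtain ⟨k, u, hu⟩ := IsDiscreteValuationRing.eq_unit_mul_pow_irreducible ha0 hπ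
  have hπ0 : φ π ≠ 0 := fun h => hπ.ne_zero <| by
    have h := congrArg Subtype.val h
    rw [hφ] at h
    exact Subtype.ext ((map_eq_zero _).mp h)
  obtain ⟨l, w, hw⟩ := IsDiscreteValuationRing.eq_unit_mul_pow_irreducible hπ0 hα
  -- `σ` fixes `π = w * α ^ l` and acts trivially on residues, so `ρ ^ l` reduces to `1`.
  have hnl : n ∣ l := by
    apply hρprim.dvd_of_pow_eq_one
    have h1 := hφG σ π
    rw [hw, smul_mul', smul_pow', hσα, mul_pow, ← mul_assoc] at h1
    have h2 := congrArg (IsLocalRing.residue B) (mul_right_cancel₀ (pow_ne_zero l hα.ne_zero) h1)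
    rw [map_mul, IsLocalRing.ResidueField.residue_smul, hI, map_pow] at h2
    exact mul_left_cancel₀ ((IsLocalRing.residue_ne_zero_iff_isUnit _).mpr w.isUnit)
      (h2.trans (mul_one _).symm)
  -- Comparing exponents of `α` in `α ^ n = u * π ^ k` gives `n = l * k`, while `n ∣ l`.
  have hk : k = 1 := by
    have h1 : α ^ n = (φ u * w ^ k) * α ^ (l * k) := by
      rw [← ha, hu, map_mul, map_pow, hw, mul_pow, ← pow_mul, mul_assoc]
    have h2 := IsDiscreteValuationRing.unit_mul_pow_congr_pow hα hα 1
      (Units.map φ.toMonoidHom u * w ^ k) n (l * k) (by simpa using h1)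
    obtain ⟨j, rfl⟩ := hnl
    have h3 : n * (j * k) = n * 1 := by rw [← mul_assoc, ← h2, mul_one]
    have h4 := Nat.eq_of_mul_eq_mul_left (by omega) h3
    exact Nat.eq_one_of_mul_eq_one_left h4
  subst hk
  rw [pow_one] at hu
  let _ : Algebra 𝓀[K₀] (IsLocalRing.ResidueField B) := (IsLocalRing.ResidueField.map φ).toAlgebra
  have hmap (x : 𝒪[K₀]) : algebraMap 𝓀[K₀] (IsLocalRing.ResidueField B)
      (IsLocalRing.residue _ x) = IsLocalRing.residue B (φ x) := rfl
  let F : IsLocalRing.ResidueField B ≃ₐ[𝓀[K₀]] IsLocalRing.ResidueField B :=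
    AlgEquiv.ofRingEquiv (f := MulSemiringAction.toRingEquiv _ _ τ) fun x => by
      obtain ⟨x, rfl⟩ := IsLocalRing.residue_surjective x
      rw [hmap]
      exact congrArg (IsLocalRing.residue B) (hφG τ x)
  have hF (b : B) : F (IsLocalRing.residue B b) = IsLocalRing.residue B (τ • b) := rfl
  obtain ⟨y, hy⟩ := FiniteField.exists_pow_eq_algebraMap F hρprim hm
    (by rw [hF, ← map_mul, hτρ, map_one]) (t := IsLocalRing.residue _ t)
    (by rw [hmap, ht, map_add, hF]) (u := IsLocalRing.residue _ (u : 𝒪[K₀]))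
    ((IsLocalRing.residue_ne_zero_iff_isUnit _).mpr u.isUnit)
  rw [hmap] at hy
  obtain ⟨v, hv, -⟩ := IsLocalRing.exists_pow_eq_of_residue_pow_eq hn_unit (u.isUnit.map φ) hy
  have hvu : IsUnit v := by
    rw [← isUnit_pow_iff (n := n) (by omega), hv]
    exact u.isUnit.map φ
  obtain ⟨v, rfl⟩ := hvu
  obtain ⟨β, hαβ⟩ : ∃ β, α = v * β := ⟨(v⁻¹ : Bˣ) * α, by rw [Units.mul_inv_cancel_left]⟩
  have hβn : β ^ n = φ π := by
    have h1 : φ u * β ^ n = φ u * φ π := by rw [← hv, ← mul_pow, ← hαβ, ← ha, hu, map_mul, hv]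
    exact (u.isUnit.map φ).mul_left_cancel h1
  refine ⟨ρ, hρL, hfinrank, hnorm, β, congrArg Subtype.val hβn, ?_⟩
  rw [← IsGalois.fixedField_fixingSubgroup (IntermediateField.adjoin K₀ {(ρ : L), (β : L)}),
    ← IntermediateField.fixedField_bot]
  congr 1
  rw [eq_bot_iff]
  intro g hg
  rw [IntermediateField.mem_fixingSubgroup_iff] at hg
  have hgρ : g • ρ = ρ :=
    Subtype.ext (hg ρ (IntermediateField.subset_adjoin _ _ (Set.mem_insert _ _)))
  have hgβ : g • β = β := Subtype.ext
    (hg β (IntermediateField.subset_adjoin _ _ (Set.mem_insert_of_mem _ rfl)))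
  have hσi (i : ℕ) : σ ^ i • ρ = ρ ∧ σ ^ i • α = ρ ^ i * α ∧
      ∀ x : IsLocalRing.ResidueField B, σ ^ i • x = x := by
    induction i with
    | zero => simp
    | succ i ih =>
      refine ⟨by rw [pow_succ, mul_smul, hσρ, ih.1], ?_,
        fun x => by rw [pow_succ, mul_smul, hI, ih.2.2]⟩
      rw [pow_succ, mul_smul, hσα, smul_mul', ih.1, ih.2.1, pow_succ']
      ring
  rw [Subgroup.mem_bot]
  obtain ⟨i, rfl | rfl⟩ := hgen g
  -- If `σ ^ i` fixes `β`, then `σ ^ i` multiplies the unit `v = α / β` by `ρ ^ i`; triviality on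
  -- residues forces `n ∣ i`.
  · have h1 := (hσi i).2.1
    rw [hαβ, smul_mul', hgβ, ← mul_assoc] at h1
    have hβ0 : β ≠ 0 := by
      intro h
      rw [h, mul_zero] at hαβ
      exact hα.ne_zero hαβ
    have h2 := congrArg (IsLocalRing.residue B) (mul_right_cancel₀ hβ0 h1)
    rw [map_mul, IsLocalRing.ResidueField.residue_smul, (hσi i).2.2, map_pow] at h2
    have h3 := mul_right_cancel₀ ((IsLocalRing.residue_ne_zero_iff_isUnit _).mpr v.isUnit)
      ((one_mul _).trans h2)
    exact orderOf_dvd_iff_pow_eq_one.mp (hσ ▸ hρprim.dvd_of_pow_eq_one i h3.symm)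
  · rw [mul_smul, (hσi i).1] at hgρ
    exact absurd hgρ hτρne

/-! ### The explicit form is dihedral -/

/-- The relations define a multiplicative map from `DihedralGroup n`; it is surjective by generation
and bijective by counting. -/
theorem DihedralGroup.nonempty_mulEquiv {G : Type*} [Group G] [Finite G] {n : ℕ} (hn : n ≠ 0)
    {σ τ : G} (hσ : σ ^ n = 1) (hτ : τ * τ = 1) (hτσ : τ * σ = σ⁻¹ * τ)
    (hgen : ∀ g : G, ∃ i : ℕ, g = σ ^ i ∨ g = σ ^ i * τ) (hcard : Nat.card G = 2 * n) :
    Nonempty (G ≃* DihedralGroup n) := by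
  have : NeZero n := ⟨hn⟩
  let s : ZMod n →+ Additive G := ZMod.lift n ⟨zmultiplesHom (Additive G) (Additive.ofMul σ), by
    simp [← ofMul_pow, hσ]⟩
  have hs (k : ℤ) : (s (k : ZMod n)).toMul = σ ^ k := by
    simp only [s, ZMod.lift_coe]
    simp
  have hadd (i j : ZMod n) : (s (i + j)).toMul = (s i).toMul * (s j).toMul := by
    rw [map_add, toMul_add]
  have hcomm (i : ZMod n) : (s i).toMul * τ = τ * (s (-i)).toMul := by
    obtain ⟨k, rfl⟩ := ZMod.intCast_surjective i
    rw [← Int.cast_neg, hs, hs]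
    have h : SemiconjBy τ σ σ⁻¹ := hτσ
    simpa using (h.zpow_right (-k)).eq.symm
  let f : DihedralGroup n → G
    | r i => (s i).toMul
    | sr i => τ * (s i).toMul
  have hf : ∀ a b, f (a * b) = f a * f b := by
    rintro (i | i) (j | j)
    · exact hadd i j
    · change τ * (s (j - i)).toMul = (s i).toMul * (τ * (s j).toMul)
      rw [← mul_assoc, hcomm, mul_assoc, ← hadd, neg_add_eq_sub]
    · change τ * (s (i + j)).toMul = τ * (s i).toMul * (s j).toMul
      rw [hadd, mul_assoc]
    · change (s (j - i)).toMul = τ * (s i).toMul * (τ * (s j).toMul)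
      rw [mul_assoc, ← mul_assoc _ τ, hcomm, mul_assoc, ← mul_assoc, hτ, one_mul, ← hadd,
        neg_add_eq_sub]
  have hsurj : Function.Surjective f := by
    intro g
    obtain ⟨i, rfl | rfl⟩ := hgen g
    · exact ⟨r ((i : ℤ) : ZMod n), (hs i).trans (zpow_natCast σ i)⟩
    · refine ⟨r ((i : ℤ) : ZMod n) * sr 0, ?_⟩
      rw [hf]
      change (s ((i : ℤ) : ZMod n)).toMul * (τ * (s 0).toMul) = _
      rw [hs, map_zero, toMul_zero, mul_one, zpow_natCast]
  have hbij : Function.Bijective f :=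
    hsurj.bijective_of_nat_card_le (by rw [hcard, DihedralGroup.nat_card])
  exact ⟨(MulEquiv.ofBijective (MulHom.mk f hf) hbij).symm⟩

/-- `L` is the splitting field of `X ^ m - a`, with `ρ` recovered as the quotient of the roots `ρ *
α` and `α`. The primitive root makes `m` nonzero in `K`, hence the polynomial separable. -/
theorem isGalois_of_adjoin_isPrimitiveRoot_root {K L : Type*} [Field K] [Field L] [Algebra K L]
    {m : ℕ} (hm : m ≠ 0) {ρ α : L} {a : K} (hρ : IsPrimitiveRoot ρ m) (ha : a ≠ 0)
    (hα : α ^ m = algebraMap K L a) (htop : IntermediateField.adjoin K {ρ, α} = ⊤) :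
    IsGalois K L := by
  have : NeZero m := ⟨hm⟩
  open Polynomial in
  have hmL : (m : L) ≠ 0 := (hρ.neZero').out
  have hmK : (m : K) ≠ 0 := fun h => hmL (by rw [← map_natCast (algebraMap K L), h, map_zero])
  have hα0 : α ≠ 0 := by
    rintro rfl
    rw [zero_pow hm] at hα
    exact ha ((map_eq_zero _).mp hα.symm)
  have hroot (x : L) (hx : x ^ m = algebraMap K L a) : x ∈ (X ^ m - C a : K[X]).rootSet L := by
    rw [mem_rootSet_of_ne (X_pow_sub_C_ne_zero (Nat.pos_of_ne_zero hm) a)]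
    simp [hx]
  have : (X ^ m - C a : K[X]).IsSplittingField K L := by
    rw [isSplittingField_iff_intermediateField]
    refine ⟨?_, ?_⟩
    · rw [Polynomial.map_sub, Polynomial.map_pow, map_X, map_C]
      exact X_pow_sub_C_splits_of_isPrimitiveRoot hρ hα
    · rw [eq_top_iff, ← htop, IntermediateField.adjoin_le_iff]
      have h1 := IntermediateField.subset_adjoin K _ (hroot α hα)
      rintro x (rfl | rfl)
      · have h2 := IntermediateField.subset_adjoin K _ (hroot (x * α)
          (by rw [mul_pow, hρ.pow_eq_one, one_mul, hα]))
        rw [← mul_div_cancel_right₀ x hα0]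
        exact div_mem h2 h1
      · exact h1
  exact IsGalois.of_separable_splitting_field (separable_X_pow_sub_C a hmK ha)

/-- In degree two the norm is the constant coefficient of the minimal polynomial, so `ρ⁻¹` is the
other root and `t` is minus the linear coefficient. -/
theorem add_inv_mem_range_of_norm_eq_one {K L : Type*} [Field K] [Field L] [Algebra K L] {ρ : L}
    (h2 : Module.finrank K (IntermediateField.adjoin K {ρ}) = 2)
    (h1 : Algebra.norm K (IntermediateField.AdjoinSimple.gen K ρ) = 1) (hρ : ρ ≠ 0) :
    ∃ t : K, ρ + ρ⁻¹ = algebraMap K L t := by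
  have : FiniteDimensional K (IntermediateField.adjoin K {ρ}) := .of_finrank_pos (by omega)
  have hint : IsIntegral K ρ := by
    rw [← IntermediateField.AdjoinSimple.isIntegral_gen]
    exact IsIntegral.of_finite K _
  have hdeg : (minpoly K ρ).natDegree = 2 := by rw [← IntermediateField.adjoin.finrank hint, h2]
  have := Algebra.PowerBasis.norm_gen_eq_coeff_zero_minpoly
    (IntermediateField.adjoin.powerBasis hint)
  rw [IntermediateField.adjoin.powerBasis_gen, IntermediateField.minpoly_gen,
    IntermediateField.adjoin.powerBasis_dim, hdeg, h1] at this
  have h := minpoly.aeval K ρ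
  have hl : (minpoly K ρ).coeff 2 = 1 := hdeg ▸ (minpoly.monic hint).coeff_natDegree
  rw [Polynomial.aeval_eq_sum_range, hdeg] at h
  simp only [Finset.sum_range_succ, Finset.sum_range_zero, hl, Algebra.smul_def,
    show (minpoly K ρ).coeff 0 = 1 by rw [this]; ring, map_one] at h
  refine ⟨-(minpoly K ρ).coeff 1, ?_⟩
  rw [map_neg]
  field_simp
  linear_combination h

theorem isDihedralExtension_of_isPrimitiveRoot {K L : Type*} [Field K] [Field L] [Algebra K L]
    {m : ℕ} (hm : 2 ≤ m) (hL : Module.finrank K L = 2 * m) {ρ α : L} {a : K}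
    (hρ : IsPrimitiveRoot ρ m) (ha : a ≠ 0)
    (h2 : Module.finrank K (IntermediateField.adjoin K {ρ}) = 2)
    (h1 : Algebra.norm K (IntermediateField.AdjoinSimple.gen K ρ) = 1)
    (hα : α ^ m = algebraMap K L a) (htop : IntermediateField.adjoin K {ρ, α} = ⊤) :
    IsDihedralExtension K L := by
  have : FiniteDimensional K L := .of_finrank_pos (by omega)
  have hGal := isGalois_of_adjoin_isPrimitiveRoot_root (by omega) hρ ha hα htop
  refine ⟨hGal, m, hm, ?_⟩
  have : NeZero m := ⟨by omega⟩
  have hcard : Nat.card (L ≃ₐ[K] L) = 2 * m := by rw [IsGalois.card_aut_eq_finrank, hL]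
  have hα0 : α ≠ 0 := by
    rintro rfl
    rw [zero_pow (by omega)] at hα
    exact ha ((map_eq_zero _).mp hα.symm)
  have hρ0 : ρ ≠ 0 := hρ.ne_zero (by omega)
  obtain ⟨t, ht⟩ := add_inv_mem_range_of_norm_eq_one h2 h1 hρ0
  have hext {g h : L ≃ₐ[K] L} (h1 : g ρ = h ρ) (h2 : g α = h α) : g = h := by
    rw [eq_comm, ← inv_mul_eq_one]
    ext x
    have := (IntermediateField.forall_mem_adjoin_smul_eq_self_iff K (S := {ρ, α})
      (h⁻¹ * g)).mpr (by
        rintro y (rfl | rfl)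
        · rw [mul_smul, AlgEquiv.smul_def g, h1, ← AlgEquiv.smul_def, inv_smul_smul]
        · rw [mul_smul, AlgEquiv.smul_def g, h2, ← AlgEquiv.smul_def, inv_smul_smul])
    exact this x (htop ▸ IntermediateField.mem_top)
  have hgρ (g : L ≃ₐ[K] L) : g ρ = ρ ∨ g ρ = ρ⁻¹ := by
    have h := congrArg g ht
    rw [map_add, map_inv₀, AlgEquiv.commutes, ← ht] at h
    have hg0 : g ρ ≠ 0 := by simpa using hρ0
    have : (g ρ - ρ) * (g ρ - ρ⁻¹) = 0 := by
      field_simp at h ⊢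
      linear_combination h
    simpa [sub_eq_zero] using this
  have hgα (g : L ≃ₐ[K] L) : ∃ i < m, g α = ρ ^ i * α := by
    obtain ⟨i, hi, h⟩ := hρ.eq_pow_of_pow_eq_one (ξ := g α / α) (by
      rw [div_pow, ← map_pow, hα, AlgEquiv.commutes, div_self]
      simpa using ha)
    exact ⟨i, hi, by rw [h, div_mul_cancel₀ _ hα0]⟩
  classical
  have := Fintype.ofFinite (L ≃ₐ[K] L)
  let T : Finset (L × L) := {ρ, ρ⁻¹} ×ˢ (Finset.range m).image fun i => ρ ^ i * α
  -- The injective map `g ↦ (g ρ, g α)` sends `2m` automorphisms into a set of at most `2m` pairs,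
  -- so every pair is attained.
  have hT : Finset.univ.image (fun g : L ≃ₐ[K] L => (g ρ, g α)) = T := by
    apply Finset.eq_of_subset_of_card_le
    · intro x hx
      obtain ⟨g, -, rfl⟩ := Finset.mem_image.mp hx
      obtain ⟨i, hi, h⟩ := hgα g
      simp only [T, Finset.mem_product, Finset.mem_insert, Finset.mem_singleton, Finset.mem_image,
        Finset.mem_range]
      exact ⟨hgρ g, i, hi, h.symm⟩
    · rw [Finset.card_image_of_injective _ (fun g h hgh => hext (congrArg Prod.fst hgh)
        (congrArg Prod.snd hgh)), Finset.card_univ, ← Nat.card_eq_fintype_card, hcard,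
        Finset.card_product]
      refine Nat.mul_le_mul Finset.card_le_two (Finset.card_image_le.trans ?_)
      rw [Finset.card_range]
  have hex {x y : L} (hx : x = ρ ∨ x = ρ⁻¹) {i : ℕ} (hi : i < m) (hy : y = ρ ^ i * α) :
      ∃ g : L ≃ₐ[K] L, g ρ = x ∧ g α = y := by
    have : (x, y) ∈ T := by
      simp only [T, Finset.mem_product, Finset.mem_insert, Finset.mem_singleton, Finset.mem_image,
        Finset.mem_range]
      exact ⟨hx, i, hi, hy.symm⟩
    rw [← hT] at this
    obtain ⟨g, -, h⟩ := Finset.mem_image.mp this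
    exact ⟨g, congrArg Prod.fst h, congrArg Prod.snd h⟩
  obtain ⟨σ, hσρ, hσα⟩ := hex (.inl rfl) (i := 1) (by omega) (by rw [pow_one])
  obtain ⟨τ, hτρ, hτα⟩ := hex (.inr rfl) (i := 0) (by omega) (by rw [pow_zero, one_mul])
  have hσi (i : ℕ) : (σ ^ i) ρ = ρ ∧ (σ ^ i) α = ρ ^ i * α := by
    induction i with
    | zero => simp
    | succ i ih =>
      rw [pow_succ, AlgEquiv.mul_apply, AlgEquiv.mul_apply, hσρ, hσα, map_mul, ih.1, ih.2]
      exact ⟨rfl, by ring⟩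
  refine DihedralGroup.nonempty_mulEquiv (by omega) (σ := σ) (τ := τ) ?_ ?_ ?_ (fun g => ?_) hcard
  · exact hext (hσi m).1 (by rw [(hσi m).2, hρ.pow_eq_one, one_mul]; rfl)
  · refine hext ?_ ?_
    · rw [AlgEquiv.mul_apply, hτρ, map_inv₀, hτρ, inv_inv]
      rfl
    · rw [AlgEquiv.mul_apply, hτα, hτα]
      rfl
  · rw [eq_inv_mul_iff_mul_eq]
    refine hext ?_ ?_
    · simp only [AlgEquiv.mul_apply, hσρ, hτρ, map_inv₀]
    · simp only [AlgEquiv.mul_apply, hσα, hτα, hτρ, hσρ, map_inv₀, map_mul]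
      rw [inv_mul_cancel_left₀ hρ0]
  · obtain ⟨i, -, hi⟩ := hgα g
    refine ⟨i, (hgρ g).imp (fun h => ?_) (fun h => ?_)⟩
    · exact hext (h.trans (hσi i).1.symm) (hi.trans (hσi i).2.symm)
    · refine hext ?_ ?_
      · rw [AlgEquiv.mul_apply, hτρ, map_inv₀, (hσi i).1, h]
      · rw [AlgEquiv.mul_apply, hτα, (hσi i).2, hi]

theorem mainTheorem12 {K₀ : Type*} [Field K₀] [ValuativeRel K₀] [TopologicalSpace K₀]
    [IsNonarchimedeanLocalField K₀]
    (m : ℕ) (hm : 3 ≤ m) (hchar : Nat.Coprime (2 * m) (ringChar 𝓀[K₀]))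
    {L : Type*} [Field L] [Algebra K₀ L] (hL : Module.finrank K₀ L = 2 * m)
    (π : 𝒪[K₀]) (hπ : Irreducible π) :
    IsDihedralExtension K₀ L ↔
      ∃ ρ : L, IsPrimitiveRoot ρ m ∧
        Module.finrank K₀ (IntermediateField.adjoin K₀ {ρ}) = 2 ∧
        Algebra.norm K₀ (IntermediateField.AdjoinSimple.gen K₀ ρ) = 1 ∧
        ∃ α : L, α ^ m = algebraMap K₀ L (π : K₀) ∧
          IntermediateField.adjoin K₀ {ρ, α} = ⊤ := by
  refine ⟨IsDihedralExtension.exists_isPrimitiveRoot m hm hchar hL π hπ, ?_⟩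
  rintro ⟨ρ, hρ, h2, h1, α, hα, htop⟩
  exact isDihedralExtension_of_isPrimitiveRoot (by omega) hL hρ
    (fun h => hπ.ne_zero (Subtype.ext h)) h2 h1 hα htop
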